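/- Let $\mathcal R$ be a von Neumann algebra acting on a complex Hilbert space $\mathcal H$, and let $\mathcal P(\mathcal R)$ be the complete lattice of orthogonal projections in $\mathcal R$ (ordered by $P\le Q$ iff $P\mathcal H\subseteq Q\mathcal H$). A quasipoint of $\mathcal P(\mathcal R)$ is a non-empty subset $\mathfrak B\subseteq\mathcal P(\mathcal R)$ that is maximal with respect to the two properties: $0\notin\mathfrak B$; and for all $P,Q\in\mathfrak B$ there is $S\in\mathfrak B$ with $S\le P\wedge Q$. The Stone spectrum $\mathcal Q(\mathcal R)$ is the set of all quasipoints of $\mathcal P(\mathcal R)$ with the topology having the sets $\mathcal Q_P(\mathcal R)=\{\mathfrak B : P\in\mathfrak B\}$, $P\in\mathcal P(\mathcal R)$, as a basis. Let $A\in\mathcal R$ be self-adjoint and let $(E_\lambda)_{\lambda\in\mathbb R}$ be its (right-continuous) spectral family, $A=\int\lambda\,dE_\lambda$; that is, $E_\lambda\in\mathcal P(\mathcal R)$ is the spectral projection of $A$ for $(-\infty,\lambda]$, the orthogonal projection onto the kernel of the positive part $(A-\lambda)^+$. Then for every $\mathfrak B\in\mathcal Q(\mathcal R)$ the set $\{\lambda\in\mathbb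 R : E_\lambda\in\mathfrak B\}$ has an infimum in $\mathbb R$ (it is non-empty and bounded below), and the observable function $$f_A:\mathcal Q(\mathcal R)\to\mathbb R,\qquad f_A(\mathfrak B)=\inf\{\lambda\in\mathbb R : E_\lambda\in\mathfrak B\},$$ is continuous. -/

import Mathlib

namespace StoneSpectrum

/-! ### Quasipoints and the Stone spectrum of a lattice -/

section Lattice

variable {L : Type*} [CompleteLattice L]

/-- A filter base in a lattice: a non-empty subset not containing `0`, any two elements `a, b` of
which admit an element `c` of the subset with `c ≤ a ∧ b`. -/
structure IsFilterBase (B : Set L) : Prop where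
  nonempty : B.Nonempty
  bot_notMem : ⊥ ∉ B
  exists_le_inf : ∀ a ∈ B, ∀ b ∈ B, ∃ c ∈ B, c ≤ a ⊓ b

variable (L) in
/-- A quasipoint of a lattice: a maximal filter base. -/
structure Quasipoint where
  carrier : Set L
  maximal : Maximal IsFilterBase carrier

instance : Membership L (Quasipoint L) where
  mem B a := a ∈ B.carrier

/-- The set of all quasipoints containing `a`. -/
def Quasipoint.basicOpen (a : L) : Set (Quasipoint L) := {B | a ∈ B}

/-- The topology of the Stone spectrum: it is generated by the sets `basicOpen a` (which are closed
under finite intersections, hence form a basis). The type `Quasipoint L` with this topology is the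
Stone spectrum of `L`. -/
instance : TopologicalSpace (Quasipoint L) :=
  TopologicalSpace.generateFrom (Set.range Quasipoint.basicOpen)

variable (L) in
/-- A bounded spectral family in a complete lattice. -/
structure BoundedSpectralFamily where
  toFun : ℝ → L
  mono : ∀ l m : ℝ, l ≤ m → toFun l ≤ toFun m
  right_cont : ∀ l : ℝ, toFun l = ⨅ m : ℝ, ⨅ _ : l < m, toFun m
  iInf_eq_bot : ⨅ l : ℝ, toFun l = ⊥
  iSup_eq_top : ⨆ l : ℝ, toFun l = ⊤
  bounded : ∃ a b : ℝ, (∀ l < a, toFun l = ⊥) ∧ ∀ l ≥ b, toFun l = ⊤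

instance : CoeFun (BoundedSpectralFamily L) (fun _ => ℝ → L) where
  coe E := E.toFun

/-- The observable function of a bounded spectral family `E`: it sends a quasipoint `B` to the
infimum of all real `l` with `E l ∈ B`. -/
noncomputable def BoundedSpectralFamily.observableFunction (E : BoundedSpectralFamily L)
    (B : Quasipoint L) : ℝ :=
  sInf {l : ℝ | E l ∈ B}

end Lattice

/-! ### The projection lattice of a von Neumann algebra -/

section VonNeumann

variable {H : Type*} [NormedAddCommGroup H] [InnerProductSpace ℂ H] [CompleteSpace H]

/-- The orthogonal projections that belong to the von Neumann algebra `R`. -/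
def Projections (R : VonNeumannAlgebra H) : Type _ :=
  {p : H →L[ℂ] H // IsStarProjection p ∧ p ∈ R}

namespace Projections

variable {R : VonNeumannAlgebra H}

/-- Projections are ordered as operators: `p ≤ q` if `q - p` is positive. -/
instance : PartialOrder (Projections R) := inferInstanceAs (PartialOrder (Subtype _))

/-- The order of projections is the inclusion of their ranges. -/
theorem le_iff_range_le (p q : Projections R) : p ≤ q ↔ p.1.range ≤ q.1.range := by
  change p.1 ≤ q.1 ↔ _
  rw [← ContinuousLinearMap.coe_le_coe_iff]
  exact LinearMap.IsSymmetricProjection.le_iff_range_le_range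
    (ContinuousLinearMap.isStarProjection_iff_isSymmetricProjection.1 p.2.1)
    (ContinuousLinearMap.isStarProjection_iff_isSymmetricProjection.1 q.2.1)

/-- The projection onto a closed subspace that is invariant under the commutant of `R`. -/
noncomputable def ofSubspace (R : VonNeumannAlgebra H) (U : Submodule ℂ H)
    (hU : IsClosed (U : Set H))
    (hR : ∀ y ∈ R.commutant, ∀ x ∈ U, y x ∈ U) : Projections R :=
  haveI : CompleteSpace U := hU.completeSpace_coe
  ⟨U.starProjection, isStarProjection_starProjection,
    (VonNeumannAlgebra.IsStarProjection.mem_iff isStarProjection_starProjection R).2 (by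
      intro y hy
      rw [Submodule.range_starProjection]
      exact fun x hx => hR y hy x hx)⟩

theorem range_ofSubspace (R : VonNeumannAlgebra H) (U : Submodule ℂ H)
    (hU : IsClosed (U : Set H)) (hR : ∀ y ∈ R.commutant, ∀ x ∈ U, y x ∈ U) :
    (ofSubspace R U hU hR).1.range = U := by
  have : CompleteSpace U := hU.completeSpace_coe
  exact Submodule.range_starProjection U

theorem isClosed_range (p : Projections R) : IsClosed (p.1.range : Set H) := by
  have := (ContinuousLinearMap.IsIdempotentElem.isClosed_range p.2.1.isIdempotentElem)
  simpa using this

/-- The infimum of a set of projections is the projection onto the intersection of their ranges. -/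
noncomputable instance : InfSet (Projections R) where
  sInf S := ofSubspace R (⨅ p ∈ S, p.1.range)
    (by
      simp only [Submodule.coe_iInf]
      exact isClosed_iInter fun p => isClosed_iInter fun _ => isClosed_range p)
    (by
      intro y hy x hx
      simp only [Submodule.mem_iInf] at hx ⊢
      intro p hp
      exact (VonNeumannAlgebra.IsStarProjection.mem_iff p.2.1 R).1 p.2.2 y hy (hx p hp))

theorem range_sInf (S : Set (Projections R)) : (sInf S).1.range = ⨅ p ∈ S, p.1.range :=
  range_ofSubspace R _ _ _

theorem isGLB_sInf (S : Set (Projections R)) : IsGLB S (sInf S) := by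
  constructor
  · intro p hp
    rw [le_iff_range_le, range_sInf]
    exact iInf₂_le p hp
  · intro q hq
    rw [le_iff_range_le, range_sInf]
    exact le_iInf₂ fun p hp => (le_iff_range_le q p).1 (hq hp)

/-- The projections of a von Neumann algebra form a complete lattice. -/
noncomputable instance : CompleteLattice (Projections R) :=
  completeLatticeOfInf (Projections R) isGLB_sInf

theorem eq_of_range_eq {p q : Projections R} (h : p.1.range = q.1.range) : p = q :=
  le_antisymm ((le_iff_range_le p q).2 h.le) ((le_iff_range_le q p).2 h.ge)

end Projections

/-! ### The spectral family of a self-adjoint operator -/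

/-- The positive part `(A - l)⁺` of `A - l`, through the continuous functional calculus. -/
noncomputable def posShift (A : H →L[ℂ] H) (l : ℝ) : H →L[ℂ] H :=
  cfc (fun x : ℝ => max (x - l) 0) A

theorem posShift_mul_sub {A : H →L[ℂ] H} (_hA : IsSelfAdjoint A) {l m : ℝ} (h : l < m) :
    cfc (fun x : ℝ => max (x - m) 0 / max (x - l) (m - l)) A * posShift A l = posShift A m := by
  have hpos : ∀ x : ℝ, 0 < max (x - l) (m - l) := fun x => lt_max_of_lt_right (by linarith)
  have hc : Continuous (fun x : ℝ => max (x - m) 0 / max (x - l) (m - l)) :=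
    Continuous.div (by fun_prop) (by fun_prop) fun x => (hpos x).ne'
  unfold posShift
  rw [← cfc_mul _ _ A hc.continuousOn (by fun_prop)]
  congr 1
  ext x
  rcases le_total x m with hx | hx
  · simp [max_eq_right (sub_nonpos.2 hx)]
  · rw [max_eq_left (show m - l ≤ x - l by linarith), max_eq_left (show 0 ≤ x - l by linarith),
      div_mul_cancel₀]
    linarith

theorem posShift_dist {A : H →L[ℂ] H} (_hA : IsSelfAdjoint A) (l m : ℝ) :
    ‖posShift A l - posShift A m‖ ≤ |l - m| := by
  unfold posShift
  rw [← cfc_sub _ _ A (by fun_prop) (by fun_prop)]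
  refine norm_cfc_le (abs_nonneg _) fun x _ => ?_
  rw [Real.norm_eq_abs]
  refine (abs_max_sub_max_le_abs _ _ _).trans (le_of_eq ?_)
  rw [abs_sub_comm l m]
  congr 1
  ring

theorem abs_le_of_mem_spectrum {A : H →L[ℂ] H} {x : ℝ} (hx : x ∈ spectrum ℝ A) :
    |x| ≤ ‖A‖ * ‖(1 : H →L[ℂ] H)‖ := by
  simpa using spectrum.norm_le_norm_mul_of_mem hx

theorem posShift_eq_zero {A : H →L[ℂ] H} {l : ℝ} (hl : ‖A‖ * ‖(1 : H →L[ℂ] H)‖ ≤ l) :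
    posShift A l = 0 := by
  unfold posShift
  rw [show (0 : H →L[ℂ] H) = cfc (fun _ : ℝ => (0 : ℝ)) A by simp]
  refine cfc_congr fun x hx => ?_
  have := (abs_le.1 (abs_le_of_mem_spectrum hx)).2
  exact max_eq_right (by linarith)

theorem ker_posShift_eq_bot {A : H →L[ℂ] H} (hA : IsSelfAdjoint A) {l : ℝ}
    (hl : l < -(‖A‖ * ‖(1 : H →L[ℂ] H)‖)) : (posShift A l).ker = ⊥ := by
  set d := -(‖A‖ * ‖(1 : H →L[ℂ] H)‖) - l with hd
  have hd0 : 0 < d := by linarith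
  have hpos : ∀ x : ℝ, 0 < max (x - l) d := fun x => lt_max_of_lt_right hd0
  have hc : Continuous (fun x : ℝ => (max (x - l) d)⁻¹) :=
    Continuous.inv₀ (by fun_prop) fun x => (hpos x).ne'
  have key : cfc (fun x : ℝ => (max (x - l) d)⁻¹) A * posShift A l = 1 := by
    unfold posShift
    rw [← cfc_mul _ _ A hc.continuousOn (by fun_prop), ← cfc_one ℝ A]
    refine cfc_congr fun x hx => ?_
    have := (abs_le.1 (abs_le_of_mem_spectrum hx)).1
    have h1 : d ≤ x - l := by rw [hd]; linarith
    simp only [max_eq_left h1, max_eq_left (hd0.le.trans h1), Pi.one_apply]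
    exact inv_mul_cancel₀ (by linarith)
  rw [eq_bot_iff]
  intro x hx
  have hx' : posShift A l x = 0 := hx
  have := congrArg (fun T : H →L[ℂ] H => T x) key
  simpa [hx'] using this.symm

theorem ker_posShift_mono {A : H →L[ℂ] H} (hA : IsSelfAdjoint A) {l m : ℝ} (h : l ≤ m) :
    (posShift A l).ker ≤ (posShift A m).ker := by
  rcases h.eq_or_lt with rfl | h
  · exact le_rfl
  intro x hx
  have hx' : posShift A l x = 0 := hx
  change posShift A m x = 0
  rw [← posShift_mul_sub hA h, mul_apply_eq_comp, hx', map_zero]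

variable {R : VonNeumannAlgebra H} {A : H →L[ℂ] H}

/-- The spectral projection `E l` of a self-adjoint `A ∈ R` for the half-line `(-∞, l]`: the
orthogonal projection onto the kernel of the positive part `(A - l)⁺`. -/
noncomputable def spectralProjection (hA : IsSelfAdjoint A) (hR : A ∈ R) (l : ℝ) : Projections R :=
  Projections.ofSubspace R (posShift A l).ker (posShift A l).isClosed_ker (by
    intro y hy x hx
    have hx' : posShift A l x = 0 := hx
    have hc : Commute A y := VonNeumannAlgebra.mem_commutant_iff.1 hy A hR
    have hc' : Commute (posShift A l) y := hA.commute_cfc hc _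
    change posShift A l (y x) = 0
    rw [← mul_apply_eq_comp, hc'.eq, mul_apply_eq_comp, hx', map_zero])

theorem range_spectralProjection (hA : IsSelfAdjoint A) (hR : A ∈ R) (l : ℝ) :
    (spectralProjection hA hR l).1.range = (posShift A l).ker :=
  Projections.range_ofSubspace R _ _ _

theorem spectralProjection_mono (hA : IsSelfAdjoint A) (hR : A ∈ R) {l m : ℝ} (h : l ≤ m) :
    spectralProjection hA hR l ≤ spectralProjection hA hR m := by
  rw [Projections.le_iff_range_le, range_spectralProjection, range_spectralProjection]
  exact ker_posShift_mono hA h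

theorem spectralProjection_eq_bot (hA : IsSelfAdjoint A) (hR : A ∈ R) {l : ℝ}
    (hl : l < -(‖A‖ * ‖(1 : H →L[ℂ] H)‖)) : spectralProjection hA hR l = ⊥ := by
  rw [eq_bot_iff, Projections.le_iff_range_le, range_spectralProjection,
    ker_posShift_eq_bot hA hl]
  exact bot_le

theorem spectralProjection_eq_top (hA : IsSelfAdjoint A) (hR : A ∈ R) {l : ℝ}
    (hl : ‖A‖ * ‖(1 : H →L[ℂ] H)‖ ≤ l) : spectralProjection hA hR l = ⊤ := by
  rw [eq_top_iff, Projections.le_iff_range_le, range_spectralProjection, posShift_eq_zero hl]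
  intro x _
  rfl

/-- The spectral family of a self-adjoint element of a von Neumann algebra, as a bounded spectral
family in the projection lattice. -/
noncomputable def spectralFamily (hA : IsSelfAdjoint A) (hR : A ∈ R) :
    BoundedSpectralFamily (Projections R) where
  toFun := spectralProjection hA hR
  mono _ _ := spectralProjection_mono hA hR
  right_cont l := by
    refine le_antisymm (le_iInf₂ fun m hm => spectralProjection_mono hA hR hm.le) ?_
    rw [Projections.le_iff_range_le, range_spectralProjection]
    intro x hx
    have hx' : ∀ m > l, posShift A m x = 0 := by
      intro m hm
      have h1 : (⨅ m : ℝ, ⨅ _ : l < m, spectralProjection hA hR m) ≤ spectralProjection hA hR m :=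
        iInf₂_le m hm
      rw [Projections.le_iff_range_le, range_spectralProjection] at h1
      exact h1 hx
    change posShift A l x = 0
    rw [← norm_le_zero_iff]
    refine le_of_forall_pos_le_add fun e he => ?_
    have hd : 0 < e / (‖x‖ + 1) := by positivity
    have h2 := ((posShift A l - posShift A (l + e / (‖x‖ + 1))).le_opNorm x).trans
      (mul_le_mul_of_nonneg_right (posShift_dist hA l (l + e / (‖x‖ + 1))) (norm_nonneg x))
    rw [sub_apply, hx' (l + e / (‖x‖ + 1)) (by linarith), sub_zero] at h2
    refine h2.trans ?_
    rw [show l - (l + e / (‖x‖ + 1)) = -(e / (‖x‖ + 1)) by ring, abs_neg, abs_of_pos hd,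
      div_mul_eq_mul_div, zero_add, div_le_iff₀ (by positivity)]
    nlinarith [norm_nonneg x]
  iInf_eq_bot := by
    rw [eq_bot_iff]
    refine (iInf_le _ (-(‖A‖ * ‖(1 : H →L[ℂ] H)‖) - 1)).trans ?_
    rw [spectralProjection_eq_bot hA hR (by linarith)]
  iSup_eq_top := by
    rw [eq_top_iff]
    refine le_trans ?_ (le_iSup _ (‖A‖ * ‖(1 : H →L[ℂ] H)‖))
    rw [spectralProjection_eq_top hA hR le_rfl]
  bounded := ⟨-(‖A‖ * ‖(1 : H →L[ℂ] H)‖), ‖A‖ * ‖(1 : H →L[ℂ] H)‖,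
    fun _ hl => spectralProjection_eq_bot hA hR hl,
    fun _ hl => spectralProjection_eq_top hA hR hl⟩

/-! The family just defined is the one of the spectral theorem: `A = ∫ l dE l`, as a norm limit of
Riemann–Stieltjes sums. -/

theorem spectralProjection_mul_of_le (hA : IsSelfAdjoint A) (hR : A ∈ R) {l m : ℝ} (h : l ≤ m) :
    (spectralProjection hA hR m).1 * (spectralProjection hA hR l).1 =
      (spectralProjection hA hR l).1 := by
  ext x
  have h1 := (Projections.le_iff_range_le _ _).1 (spectralProjection_mono hA hR h)
  obtain ⟨y, hy⟩ := h1 (LinearMap.mem_range_self _ x)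
  have hy' : (spectralProjection hA hR m).1 y = (spectralProjection hA hR l).1 x := hy
  rw [mul_apply_eq_comp, ← hy', ← mul_apply_eq_comp,
    (spectralProjection hA hR m).2.1.isIdempotentElem.eq]

theorem posShift_mul_spectralProjection (hA : IsSelfAdjoint A) (hR : A ∈ R) (l : ℝ) :
    posShift A l * (spectralProjection hA hR l).1 = 0 := by
  ext x
  have h1 : (spectralProjection hA hR l).1 x ∈ (posShift A l).ker := by
    rw [← range_spectralProjection hA hR l]
    exact LinearMap.mem_range_self _ x
  exact h1

theorem spectralProjection_mul_of_posShift_mul (hA : IsSelfAdjoint A) (hR : A ∈ R) {l : ℝ}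
    {T : H →L[ℂ] H} (hT : posShift A l * T = 0) : (spectralProjection hA hR l).1 * T = T := by
  ext x
  have h1 : T x ∈ (posShift A l).ker := congrArg (fun S : H →L[ℂ] H => S x) hT
  rw [← range_spectralProjection hA hR l] at h1
  obtain ⟨y, hy⟩ := h1
  have hy' : (spectralProjection hA hR l).1 y = T x := hy
  rw [mul_apply_eq_comp, ← hy', ← mul_apply_eq_comp,
    (spectralProjection hA hR l).2.1.isIdempotentElem.eq]

theorem spectralProjection_commute (hA : IsSelfAdjoint A) (hR : A ∈ R) (l : ℝ) :
    A * (spectralProjection hA hR l).1 = (spectralProjection hA hR l).1 * A := by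
  have hc : Commute (posShift A l) A := hA.commute_cfc (Commute.refl A) _
  have h1 := spectralProjection_mul_of_posShift_mul hA hR (l := l)
    (T := A * (spectralProjection hA hR l).1) (by
      rw [← mul_assoc, hc.eq, mul_assoc, posShift_mul_spectralProjection, mul_zero])
  have h2 := congrArg star h1
  simp only [star_mul, hA.star_eq, (spectralProjection hA hR l).2.1.isSelfAdjoint.star_eq] at h2
  rw [← h1, ← h2, mul_assoc]

theorem Projections.bot_coe : (⊥ : Projections R).1 = 0 := by
  have h : (⊥ : Projections R).1.range ≤ (0 : H →L[ℂ] H).range :=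
    (Projections.le_iff_range_le ⊥ ⟨0, .zero _, zero_mem R⟩).1 bot_le
  ext x
  obtain ⟨y, hy⟩ := h (LinearMap.mem_range_self _ x)
  exact hy.symm

theorem Projections.top_coe : (⊤ : Projections R).1 = 1 := by
  have h : (1 : H →L[ℂ] H).range ≤ (⊤ : Projections R).1.range :=
    (Projections.le_iff_range_le ⟨1, .one _, one_mem R⟩ ⊤).1 le_top
  ext x
  obtain ⟨y, hy⟩ := h (LinearMap.mem_range_self _ x)
  have hy' : (⊤ : Projections R).1 y = x := hy
  rw [← hy', ← mul_apply_eq_comp, (⊤ : Projections R).2.1.isIdempotentElem.eq, hy']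
  rfl

/-- With `F = E m - E l` for `l ≤ m`, one has `l F ≤ A F ≤ m F`. -/
theorem spectralProjection_sub_bounds (hA : IsSelfAdjoint A) (hR : A ∈ R) {l m : ℝ} (h : l ≤ m)
    {F : H →L[ℂ] H} (hF : F = (spectralProjection hA hR m).1 - (spectralProjection hA hR l).1) :
    0 ≤ F ∧ l • F ≤ A * F ∧ A * F ≤ m • F := by
  have hml := spectralProjection_mul_of_le hA hR h
  have hll := (spectralProjection hA hR l).2.1.isIdempotentElem.eq
  have hmm := (spectralProjection hA hR m).2.1.isIdempotentElem.eq
  have hlm := congrArg star hml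
  simp only [star_mul, (spectralProjection hA hR l).2.1.isSelfAdjoint.star_eq,
    (spectralProjection hA hR m).2.1.isSelfAdjoint.star_eq] at hlm
  have hFs : star F = F := by
    rw [hF, star_sub, (spectralProjection hA hR l).2.1.isSelfAdjoint.star_eq,
      (spectralProjection hA hR m).2.1.isSelfAdjoint.star_eq]
  have hFF : F * F = F := by
    rw [hF, mul_sub, sub_mul, sub_mul, hmm, hlm, hml, hll]
    abel
  have hAF : A * F = F * A := by
    rw [hF, mul_sub, sub_mul, spectralProjection_commute, spectralProjection_commute]
  have hAFF : A * F = F * A * F := by rw [← hAF, mul_assoc, hFF]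
  have hpos : ∀ T : H →L[ℂ] H, 0 ≤ T → 0 ≤ F * T * F := by
    intro T hT
    have := star_left_conjugate_nonneg hT F
    rwa [hFs] at this
  have hsub : ∀ c : ℝ, A - c • 1 = posShift A c - cfc (fun x : ℝ => max (c - x) 0) A := by
    intro c
    have h1 : cfc (fun x : ℝ => x - c) A = A - c • 1 := by
      rw [cfc_sub _ _ A (by fun_prop) (by fun_prop), cfc_id' ℝ A, cfc_const c A,
        Algebra.algebraMap_eq_smul_one]
    rw [← h1, posShift, ← cfc_sub _ _ A (by fun_prop) (by fun_prop)]
    congr 1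
    ext x
    rcases le_total x c with hx | hx
    · rw [max_eq_right (by linarith), max_eq_left (by linarith)]
      ring
    · rw [max_eq_left (by linarith), max_eq_right (by linarith)]
      ring
  have hneg : ∀ c : ℝ, 0 ≤ cfc (fun x : ℝ => max (c - x) 0) A :=
    fun c => cfc_nonneg fun x _ => le_max_right _ _
  have hexp : ∀ c : ℝ, F * (A - c • 1) * F = A * F - c • F := by
    intro c
    rw [mul_sub, sub_mul, ← hAFF]
    simp [hFF]
  refine ⟨by simpa [hFF] using hpos 1 zero_le_one, ?_, ?_⟩
  · rw [← sub_nonneg, ← hexp, hsub]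
    have hz : posShift A l * cfc (fun x : ℝ => max (l - x) 0) A = 0 := by
      rw [posShift, ← cfc_mul _ _ A (by fun_prop) (by fun_prop)]
      rw [show (0 : H →L[ℂ] H) = cfc (fun _ : ℝ => (0 : ℝ)) A by simp]
      congr 1
      ext x
      rcases le_total x l with hx | hx
      · rw [max_eq_right (by linarith), zero_mul]
      · rw [max_eq_right (a := l - x) (by linarith), mul_zero]
    have hq := spectralProjection_mul_of_posShift_mul hA hR hz
    have hFq : F * cfc (fun x : ℝ => max (l - x) 0) A = 0 := by
      rw [← hq, ← mul_assoc, hF, sub_mul, hml, hll, sub_self, zero_mul]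
    rw [mul_sub, hFq, sub_zero]
    exact hpos _ (cfc_nonneg fun x _ => le_max_right _ _)
  · rw [← sub_nonpos, ← hexp, hsub]
    have hpF : posShift A m * F = 0 := by
      have h1 : F = (spectralProjection hA hR m).1 * F := by rw [hF, mul_sub, hmm, hml]
      rw [h1, ← mul_assoc, posShift_mul_spectralProjection, zero_mul]
    rw [mul_assoc, sub_mul, hpF, zero_sub, mul_neg, neg_nonpos, ← mul_assoc]
    exact hpos _ (hneg m)

/-- Every Riemann–Stieltjes sum of mesh at most `d` is within `d` of `A` in operator norm. -/
theorem norm_sub_sum_spectralFamily_le (hA : IsSelfAdjoint A) (hR : A ∈ R) (n : ℕ) (t s : ℕ → ℝ)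
    (d : ℝ) (h0 : spectralFamily hA hR (t 0) = ⊥) (hn : spectralFamily hA hR (t n) = ⊤)
    (hs : ∀ i < n, s i ∈ Set.Icc (t i) (t (i + 1))) (hd : ∀ i < n, t (i + 1) - t i ≤ d)
    (hd0 : 0 ≤ d) :
    ‖A - ∑ i ∈ Finset.range n,
      s i • ((spectralFamily hA hR (t (i + 1))).1 - (spectralFamily hA hR (t i)).1)‖ ≤ d := by
  set F : ℕ → (H →L[ℂ] H) := fun i =>
    (spectralFamily hA hR (t (i + 1))).1 - (spectralFamily hA hR (t i)).1 with hF
  have hsum : ∑ i ∈ Finset.range n, F i = 1 := by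
    rw [hF, Finset.sum_range_sub fun i => (spectralFamily hA hR (t i)).1, h0, hn,
      Projections.bot_coe, Projections.top_coe, sub_zero]
  have hX : A - ∑ i ∈ Finset.range n, s i • F i =
      ∑ i ∈ Finset.range n, (A * F i - s i • F i) := by
    rw [Finset.sum_sub_distrib, ← Finset.mul_sum, hsum, mul_one]
  have hb : ∀ i ∈ Finset.range n,
      -(d • F i) ≤ A * F i - s i • F i ∧ A * F i - s i • F i ≤ d • F i := by
    intro i hi
    have hi' := Finset.mem_range.1 hi
    obtain ⟨h1, h2⟩ := hs i hi'
    obtain ⟨p, q, r⟩ := spectralProjection_sub_bounds hA hR (h1.trans h2) (F := F i) rfl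
    have h3 := hd i hi'
    constructor
    · have h4 : (s i - d) • F i ≤ t i • F i := smul_le_smul_of_nonneg_right (by linarith) p
      have h5 := h4.trans q
      rw [sub_smul] at h5
      rw [neg_le_sub_iff_le_add]
      rwa [sub_le_iff_le_add] at h5
    · have h4 : t (i + 1) • F i ≤ (d + s i) • F i := smul_le_smul_of_nonneg_right (by linarith) p
      have h5 := r.trans h4
      rw [add_smul] at h5
      rwa [sub_le_iff_le_add]
  have hup : A - ∑ i ∈ Finset.range n, s i • F i ≤ algebraMap ℝ _ d := by
    rw [hX, Algebra.algebraMap_eq_smul_one, ← hsum, Finset.smul_sum]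
    exact Finset.sum_le_sum fun i hi => (hb i hi).2
  have hlo : algebraMap ℝ _ (-d) ≤ A - ∑ i ∈ Finset.range n, s i • F i := by
    rw [hX, Algebra.algebraMap_eq_smul_one, ← hsum, Finset.smul_sum]
    refine Finset.sum_le_sum fun i hi => ?_
    rw [neg_smul]
    exact (hb i hi).1
  have hsa : IsSelfAdjoint (A - ∑ i ∈ Finset.range n, s i • F i) := by
    have h1 := hlo
    rw [← sub_nonneg] at h1
    have h2 := (IsSelfAdjoint.of_nonneg h1).add (IsSelfAdjoint.algebraMap (H →L[ℂ] H)
      (IsSelfAdjoint.all (-d)))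
    simpa using h2
  rw [← cfc_id' ℝ (A - ∑ i ∈ Finset.range n, s i • F i)]
  refine norm_cfc_le hd0 fun x hx => ?_
  rw [Real.norm_eq_abs, abs_le]
  exact ⟨(algebraMap_le_iff_le_spectrum hsa).1 hlo x hx,
    (le_algebraMap_iff_spectrum_le hsa).1 hup x hx⟩

/-- The observable function of a self-adjoint element `A` of a von Neumann algebra `R`, on the
Stone spectrum of the projection lattice of `R`. -/
noncomputable def observableFunction (hA : IsSelfAdjoint A) (hR : A ∈ R) :
    Quasipoint (Projections R) → ℝ :=
  (spectralFamily hA hR).observableFunction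

end VonNeumann

end StoneSpectrum

/-! The statement is lattice-theoretic: it holds for a monotone family `E` in a complete lattice
that is `⊥` far to the left and `⊤` far to the right, and the spectral family of `A` is such a
family. The key is a disjointness criterion extracted from maximality: `a ∉ B` exactly when some `p
∈ B` satisfies `p ⊓ a = ⊥` (`exists_inf_eq_bot_of_notMem`, with `inf_ne_bot` for the converse).
Hence both `a ∈ B` and `a ∉ B` are open conditions on `B`, that is, every `basicOpen a` is clopen.
Continuity is then checked at each bound `c`. If `f B < c`, some `E l ∈ B` with `l < c` witnesses
this on all of `basicOpen (E l)`. If `c < f B`, then `E l ∉ B` for some `l > c`, and an element of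
`B` disjoint from `E l` witnesses this on a neighbourhood. -/

namespace StoneSpectrum

section Lattice

variable {L : Type*} [CompleteLattice L]

/-! ### Maximality of quasipoints and disjointness. -/

namespace Quasipoint

/-- Otherwise `a` could be adjoined to `B`: the elements lying above some `p ⊓ a` with `p ∈ B` would
form a filter base containing both `B` and `a`, against maximality. No distributivity is needed. -/
theorem exists_inf_eq_bot_of_notMem (B : Quasipoint L) {a : L} (ha : a ∉ B) :
    ∃ p ∈ B, p ⊓ a = ⊥ := by
  by_contra! h
  have hB := B.maximal.prop
  -- Closing upwards is what makes this set contain `B`; the meets `p ⊓ a` alone need not.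
  have hF : IsFilterBase {q : L | ∃ p ∈ B.carrier, p ⊓ a ≤ q ∧ q ≠ ⊥} := by
    obtain ⟨p, hp⟩ := hB.nonempty
    refine ⟨⟨p, p, hp, inf_le_left, fun h0 => hB.bot_notMem (h0 ▸ hp)⟩, fun ⟨_, _, _, h0⟩ => h0 rfl,
      ?_⟩
    rintro q ⟨p, hp, hpq, -⟩ q' ⟨p', hp', hpq', -⟩
    obtain ⟨c, hc, hcp⟩ := hB.exists_le_inf p hp p' hp'
    exact ⟨c ⊓ a, ⟨c, hc, le_rfl, h c hc⟩,
      le_inf ((inf_le_inf_right a (hcp.trans inf_le_left)).trans hpq)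
        ((inf_le_inf_right a (hcp.trans inf_le_right)).trans hpq')⟩
  have hle : B.carrier ≤ {q : L | ∃ p ∈ B.carrier, p ⊓ a ≤ q ∧ q ≠ ⊥} :=
    fun p hp => ⟨p, hp, inf_le_left, fun h0 => hB.bot_notMem (h0 ▸ hp)⟩
  obtain ⟨p, hp⟩ := hB.nonempty
  exact ha (B.maximal.le_of_ge hF hle
    ⟨p, hp, inf_le_right, fun h0 => h p hp (by rw [h0, inf_bot_eq])⟩)

theorem bot_notMem (B : Quasipoint L) : ⊥ ∉ B :=
  B.maximal.prop.bot_notMem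

theorem top_mem (B : Quasipoint L) : ⊤ ∈ B := by
  by_contra h
  obtain ⟨p, hp, hp0⟩ := B.exists_inf_eq_bot_of_notMem h
  rw [inf_top_eq] at hp0
  exact B.bot_notMem (hp0 ▸ hp)

/-- This is what transfers disjointness to other quasipoints: one that contains `p` contains nothing
disjoint from `p`. -/
theorem inf_ne_bot (B : Quasipoint L) {a b : L} (ha : a ∈ B) (hb : b ∈ B) : a ⊓ b ≠ ⊥ := by
  intro h
  obtain ⟨c, hc, hcab⟩ := B.maximal.prop.exists_le_inf a ha b hb
  rw [h, le_bot_iff] at hcab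
  exact B.bot_notMem (hcab ▸ hc)

theorem isOpen_basicOpen (a : L) : IsOpen (basicOpen a) :=
  TopologicalSpace.isOpen_generateFrom_of_mem ⟨a, rfl⟩

end Quasipoint

/-! ### Observable functions of bounded spectral families. -/

namespace BoundedSpectralFamily

variable (E : BoundedSpectralFamily L)

/-- Boundedness of `E` makes the set non-empty and bounded below, so the real `sInf` is a genuine
infimum and not the default value `0`. -/
theorem isGLB_observableFunction (B : Quasipoint L) :
    IsGLB {l : ℝ | E l ∈ B} (E.observableFunction B) := by
  obtain ⟨a, b, ha, hb⟩ := E.bounded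
  refine Real.isGLB_sInf ⟨b, ?_⟩ ⟨a, fun l hl => ?_⟩
  · change E b ∈ B
    rw [hb b le_rfl]
    exact B.top_mem
  · by_contra! h
    have hl' : E l ∈ B := hl
    rw [ha l h] at hl'
    exact B.bot_notMem hl'

theorem continuous_observableFunction : Continuous E.observableFunction := by
  refine continuous_iff_continuousAt.2 fun B => tendsto_order.2 ⟨fun c hc => ?_, fun c hc => ?_⟩
  -- The lower bound found near `B` is only `l ≤ f B'`; taking `l` strictly above `c` makes it
  -- strict.
  · obtain ⟨l, hcl, hl⟩ := exists_between hc
    have hlB : E l ∉ B := fun h => hl.not_ge ((E.isGLB_observableFunction B).1 h)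
    obtain ⟨p, hp, hpl⟩ := B.exists_inf_eq_bot_of_notMem hlB
    filter_upwards [(Quasipoint.isOpen_basicOpen p).mem_nhds hp] with B' hB'
    refine hcl.trans_le ((E.isGLB_observableFunction B').2 fun m hm => ?_)
    -- If `m < l`, monotonicity puts `E m` below `E l`, so `p` would be disjoint from `E m` although
    -- `B'` contains both.
    by_contra! hml
    exact B'.inf_ne_bot hB' hm (le_bot_iff.1 ((inf_le_inf_left p (E.mono m l hml.le)).trans hpl.le))
  · obtain ⟨l, hl, -, hlc⟩ := (E.isGLB_observableFunction B).exists_between hc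
    filter_upwards [(Quasipoint.isOpen_basicOpen (E l)).mem_nhds hl] with B' hB'
    exact ((E.isGLB_observableFunction B').1 hB').trans_lt hlc

end BoundedSpectralFamily

end Lattice

end StoneSpectrum

theorem theorem2p3 {H : Type*} [NormedAddCommGroup H] [InnerProductSpace ℂ H] [CompleteSpace H]
    (R : VonNeumannAlgebra H) (A : H →L[ℂ] H) (hA : IsSelfAdjoint A) (hR : A ∈ R) :
    (∀ B : StoneSpectrum.Quasipoint (StoneSpectrum.Projections R),
      IsGLB {l : ℝ | StoneSpectrum.spectralFamily hA hR l ∈ B}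
        (StoneSpectrum.observableFunction hA hR B)) ∧
    Continuous (StoneSpectrum.observableFunction hA hR) :=
  ⟨(StoneSpectrum.spectralFamily hA hR).isGLB_observableFunction,
    (StoneSpectrum.spectralFamily hA hR).continuous_observableFunction⟩
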